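/- Let $n\ge 1$ be an integer. Mark the $2n$ hours $1,\dots,2n$ of a clock by a uniformly random permutation of the multiset $\{1,1,2,2,\dots,n,n\}$. Starting from hour $0=2n$, move clockwise to the first hour marked $1$, continue clockwise to the first hour marked $2$, and so on, until the first hour marked $n$ is encountered, at a random hour $I_n\in\{1,\dots,2n\}$. Put $b_n(u)=B_n(u)/n!$, where $B_n$ is the $n$th Bernoulli polynomial (so that $B_1(u)=u-\tfrac12$), and, for $1\le k\le 2n$, $$\delta_{k:2n}=\frac1{2n}-\mathbb P(I_n=k),\qquad f_{k:2n}(u)=\frac{(2n)!}{(k-1)!\,(2n-k)!}\,u^{k-1}(1-u)^{2n-k}.$$ 1. The law of $I_n$ is also that of the index obtained from the following continuous clock. Let $U_1,U_1',\dots,U_n,U_n'$ be independent and uniformly distributed on the circle $[0,1)$, with order statistics $U_{1:2n}<\dots<U_{2n:2n}$ (they are almost surely distinct). Starting from $0$, move clockwise (in the increasing direction modulo $1$) to the first of $U_1,U_1'$, then clockwise to the first of $U_2,U_2'$, and so on, until the first of $U_n,U_n'$ is encountered; the index is the $k$ for which this last point is $U_{k:2n}$. 2. For all real $u$, $$b_n(u)=\frac1{2^n}\sum_{k=1}^{2n}\delta_{k:2n}\,f_{k:2n}(u).$$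 3. For $1\le k\le 2n$, $\ \delta_{2n+1-k:2n}=(-1)^n\,\delta_{k:2n}$. 4. $\displaystyle \mathbb P(I_n=1)=\frac{1-2^n\,b_n(0)}{2n}.$ -/

import Mathlib

open MeasureTheory ProbabilityTheory
open scoped Nat

namespace BernoulliClock

/-- The factorially normalized Bernoulli polynomial `b_n(u) = B_n(u) / n!`. -/
noncomputable def b (n : ℕ) (u : ℝ) : ℝ := bernoulliFun n u / (n ! : ℝ)

/-- The normalized Bernstein polynomial `f_{k:N}` of degree `N - 1`, used for `1 ≤ k ≤ N`. -/
noncomputable def f (k N : ℕ) (u : ℝ) : ℝ :=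
  (N ! : ℝ) / (((k - 1)! : ℝ) * ((N - k)! : ℝ)) * u ^ (k - 1) * (1 - u) ^ (N - k)

/-! ### The clock with random hours -/

/-- The permutations of the multiset `{1, 1, 2, 2, …, n, n}`: markings of the `2n` hours in which
every mark is used exactly twice. Both are numbered from zero here: `h : Fin (2 * n)` stands for
hour `h + 1`, and `i : Fin n` for the mark `i + 1`. -/
def Marking (n : ℕ) : Type :=
  {τ : Fin (2 * n) → Fin n // ∀ i, (Finset.univ.filter fun h => τ h = i).card = 2}

/-- A walker leaves hour `0 = 2n` at time `0` and moves clockwise by one hour per unit of time, so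
that hour `j` is visited at the positive times congruent to `j` modulo `2n`.
`nextTime τ t i` is the first time after `t` at which the walker is at an hour marked `i`. -/
noncomputable def nextTime {n : ℕ} (τ : Fin (2 * n) → Fin n) (t : ℕ) (i : Fin n) : ℕ :=
  sInf {s : ℕ | t < s ∧ ∃ h : Fin (2 * n), τ h = i ∧ s ≡ (h : ℕ) + 1 [MOD 2 * n]}

/-- The time at which the walk to the first `1`, then to the next `2`, …, then to the next `n`
ends. -/
noncomputable def finalTime {n : ℕ} (τ : Fin (2 * n) → Fin n) : ℕ :=
  Fin.foldl n (fun t i => nextTime τ t i) 0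

/-- The hour `I_n ∈ {1, …, 2n}` at which the walk ends. -/
noncomputable def finalHour {n : ℕ} (τ : Fin (2 * n) → Fin n) : ℕ :=
  (finalTime τ - 1) % (2 * n) + 1

/-- `P(I_n = k)` for a uniformly random permutation of the multiset `{1, 1, 2, 2, …, n, n}`. -/
noncomputable def p (k n : ℕ) : ℝ :=
  (Nat.card {τ : Marking n // finalHour τ.1 = k} : ℝ) / (Nat.card (Marking n) : ℝ)

/-- `δ_{k:2n} = 1 / (2n) - P(I_n = k)`. -/
noncomputable def δ (k n : ℕ) : ℝ := 1 / (2 * (n : ℝ)) - p k n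

/-! ### The clock with random positions on the circle `[0, 1)` -/

/-- The one of two points `x, y` of the circle `[0, 1)` that is met first when moving clockwise
(in the increasing direction, modulo `1`) from `a`. -/
noncomputable def firstFrom (a x y : ℝ) : ℝ :=
  if Int.fract (x - a) ≤ Int.fract (y - a) then x else y

/-- The end of the walk that starts from `0` and moves clockwise to the first point of the first
pair, then to the first point of the second pair, and so on; the `i`-th pair is
`u (i, 0), u (i, 1)`. -/
noncomputable def finalPosition {n : ℕ} (u : Fin n × Fin 2 → ℝ) : ℝ :=
  Fin.foldl n (fun a i => firstFrom a (u (i, 0)) (u (i, 1))) 0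

/-- The index `I_n` of the end of the walk in the increasing rearrangement
`u_{1:2n} < … < u_{2n:2n}` of the `2n` (distinct) points. -/
noncomputable def finalIndex {n : ℕ} (u : Fin n × Fin 2 → ℝ) : ℕ :=
  (Finset.univ.filter fun q => u q ≤ finalPosition u).card

end BernoulliClock

namespace BernoulliClock

/-! ### Walks and ranks -/

/-! The law of the end of the continuous walk is computed in two ways. The walk sees only the ranks
of the `2n` points (`IsRanking.finalIndex_eq`). The ranking is a uniform bijection and every marking
comes from equally many bijections, so the index has law `p` (`p_eq_card_ranking`). The ranking is
moreover independent of the order statistics (`cube_finalIndex_inter`), and `f k (2 * n)` is the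
density of the `k`-th of them. Hence the end has density `∑ p k n * f k (2 * n)`. On the other hand,
each step advances by an independent amount of density `2 (1 - t) = 1 - 2 b_1(t)`. On the circle
`b_m * b_1 = -b_{m+1}` for convolution, so after `n` steps the density is `1 - 2^n b_n`
(`map_finalPosition`). Equating the two gives `sum_p_mul_f`. The expansion of `b_n` follows from `∑
f k (2 * n) = 2n`, the symmetry of `δ` from that of `b_n` and the independence of the Bernstein
polynomials, and `p 1 n` from the value at `u = 0`. -/

theorem foldl_invariant {α β : Type*} (P : ℕ → α → β → Prop) {n : ℕ} (f : α → Fin n → α)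
    (g : β → Fin n → β) (a : α) (b : β) (h0 : P 0 a b)
    (hs : ∀ (i : Fin n) x y, P i x y → P (i + 1) (f x i) (g y i)) :
    P n (Fin.foldl n f a) (Fin.foldl n g b) := by
  induction n with
  | zero => simpa using h0
  | succ n ih =>
    rw [Fin.foldl_succ_last, Fin.foldl_succ_last]
    exact hs (Fin.last n) _ _ (ih _ _ fun i x y h => hs i.castSucc x y h)

/-- The marking of the hours that is obtained by giving to the hours the points of which they are
the ranks. -/
def markingOf {n : ℕ} (σ : Fin n × Fin 2 ≃ Fin (2 * n)) (h : Fin (2 * n)) : Fin n :=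
  (σ.symm h).1

theorem markingOf_eq_iff {n : ℕ} (σ : Fin n × Fin 2 ≃ Fin (2 * n)) (h : Fin (2 * n)) (i : Fin n) :
    markingOf σ h = i ↔ h = σ (i, 0) ∨ h = σ (i, 1) := by
  obtain ⟨⟨j, e⟩, rfl⟩ := σ.surjective h
  simp only [markingOf, Equiv.symm_apply_apply, EmbeddingLike.apply_eq_iff_eq, Prod.mk.injEq]
  have : e = 0 ∨ e = 1 := by omega
  tauto

theorem card_filter_markingOf {n : ℕ} (σ : Fin n × Fin 2 ≃ Fin (2 * n)) (i : Fin n) :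
    (Finset.univ.filter fun h => markingOf σ h = i).card = 2 := by
  have : (Finset.univ.filter fun h => markingOf σ h = i) = {σ (i, 0), σ (i, 1)} := by
    ext h
    simp [markingOf_eq_iff]
  rw [this, Finset.card_pair]
  simp

theorem fract_sub_of_mem {a x : ℝ} (ha : 0 ≤ a) (ha1 : a < 1) (hx : 0 ≤ x) (hx1 : x < 1) :
    Int.fract (x - a) = if a ≤ x then x - a else x - a + 1 := by
  split_ifs with h
  · exact Int.fract_eq_self.2 ⟨by linarith, by linarith⟩
  · rw [Int.fract_eq_iff]
    exact ⟨by linarith, by linarith, -1, by push_cast; ring⟩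

/-- The number of hours from hour `r` to the next visit of hour `h`. -/
def hoursUntil (N r h : ℕ) : ℕ := if r < h then h - r else h + N - r

theorem modEq_add_hoursUntil {N r t h : ℕ} (hr : r ≤ N) (ht : t ≡ r [MOD N]) :
    t + hoursUntil N r h ≡ h [MOD N] := by
  have h1 : t + hoursUntil N r h ≡ r + hoursUntil N r h [MOD N] := ht.add_right _
  refine h1.trans ?_
  unfold hoursUntil
  split_ifs with h2
  · rw [Nat.add_sub_cancel' h2.le]
  · rw [Nat.add_sub_cancel' (by omega)]
    simp [Nat.ModEq]

theorem add_hoursUntil_le {N r t h s : ℕ} (hr : r ≤ N) (hh : h ≤ N) (ht : t ≡ r [MOD N])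
    (hts : t < s) (hs : s ≡ h [MOD N]) (h1 : 1 ≤ h) : t + hoursUntil N r h ≤ s := by
  by_contra hlt
  push Not at hlt
  have h2 : s ≡ t + hoursUntil N r h [MOD N] := hs.trans (modEq_add_hoursUntil hr ht).symm
  have h3 : N ∣ t + hoursUntil N r h - s := (Nat.modEq_iff_dvd' hlt.le).1 h2
  have h4 := Nat.le_of_dvd (by omega) h3
  have h5 : hoursUntil N r h ≤ N := by unfold hoursUntil; split_ifs <;> omega
  omega

/-- A mark sits at exactly two hours, so the wait is the smaller of two waits. Allowing `r = 0`
covers the start as well as the hours `1, …, 2n`. -/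
theorem nextTime_markingOf {n : ℕ} (σ : Fin n × Fin 2 ≃ Fin (2 * n)) {t r : ℕ} (i : Fin n)
    (hr : r ≤ 2 * n) (ht : t ≡ r [MOD 2 * n]) :
    nextTime (markingOf σ) t i = t + min (hoursUntil (2 * n) r (σ (i, 0) + 1))
      (hoursUntil (2 * n) r (σ (i, 1) + 1)) := by
  have hpos : ∀ h : Fin (2 * n), 0 < hoursUntil (2 * n) r (h + 1) := by
    intro h
    unfold hoursUntil
    split_ifs <;> omega
  refine IsLeast.csInf_eq ⟨⟨?_, ?_⟩, ?_⟩
  · have := hpos (σ (i, 0))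
    have := hpos (σ (i, 1))
    omega
  · rcases le_total (hoursUntil (2 * n) r (σ (i, 0) + 1)) (hoursUntil (2 * n) r (σ (i, 1) + 1))
      with h | h
    · rw [min_eq_left h]
      exact ⟨σ (i, 0), by simp [markingOf], modEq_add_hoursUntil hr ht⟩
    · rw [min_eq_right h]
      exact ⟨σ (i, 1), by simp [markingOf], modEq_add_hoursUntil hr ht⟩
  · rintro s ⟨hts, h, hm, hs⟩
    have := add_hoursUntil_le hr (by omega) ht hts hs (by omega)
    rcases (markingOf_eq_iff σ h i).1 hm with rfl | rfl <;> omega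

/-- `u` has distinct coordinates in `(0, 1)`, and `σ` gives their ranks, counted from zero. -/
def IsRanking {n : ℕ} (σ : Fin n × Fin 2 ≃ Fin (2 * n)) (u : Fin n × Fin 2 → ℝ) : Prop :=
  (∀ q, u q ∈ Set.Ioo (0 : ℝ) 1) ∧ ∀ q q', u q < u q' ↔ σ q < σ q'

/-- One step of the coupling of the two walks. Position `a` and hour `r` are tied only by `hlt`,
which also fits the start `a = 0`, `r = 0`, where no point lies. -/
theorem firstFrom_nextTime {n : ℕ} {σ : Fin n × Fin 2 ≃ Fin (2 * n)} {u : Fin n × Fin 2 → ℝ}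
    (hu : IsRanking σ u) {a : ℝ} {t r : ℕ} (i : Fin n) (ha : 0 ≤ a) (ha1 : a < 1)
    (hr : r ≤ 2 * n) (ht : t ≡ r [MOD 2 * n]) (hne : ∀ e, u (i, e) ≠ a)
    (hlt : ∀ e, r < σ (i, e) + 1 ↔ a < u (i, e)) :
    ∃ q : Fin n × Fin 2, q.1 = i ∧ firstFrom a (u (i, 0)) (u (i, 1)) = u q ∧
      0 < nextTime (markingOf σ) t i ∧ nextTime (markingOf σ) t i ≡ σ q + 1 [MOD 2 * n] := by
  have hF : ∀ e, Int.fract (u (i, e) - a) =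
      if r < σ (i, e) + 1 then u (i, e) - a else u (i, e) - a + 1 := by
    intro e
    rw [fract_sub_of_mem ha ha1 (hu.1 _).1.le (hu.1 _).2]
    have h1 := hlt e
    have h2 := (hne e).symm.le_iff_lt
    simp only [h1, h2]
  -- If both points are ahead, or both behind, the ranks decide; otherwise the point ahead is met
  -- before the lap ends, in both clocks.
  have key : Int.fract (u (i, 0) - a) ≤ Int.fract (u (i, 1) - a) ↔
      hoursUntil (2 * n) r (σ (i, 0) + 1) ≤ hoursUntil (2 * n) r (σ (i, 1) + 1) := by
    rw [hF, hF]
    have h0 := hlt 0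
    have h1 := hlt 1
    have h2 := hu.2 (i, 1) (i, 0)
    have b0 := hu.1 (i, 0)
    have b1 := hu.1 (i, 1)
    rw [Fin.lt_def] at h2
    unfold hoursUntil
    split_ifs with c0 c1 c1
    · rw [← not_lt, ← not_lt, sub_lt_sub_iff_right, h2]
      omega
    · have := h0.1 c0
      exact ⟨fun _ => by omega, fun _ => by linarith [b0.2, b1.1]⟩
    · exact ⟨fun h => by linarith [b0.1, b1.2], fun _ => by omega⟩
    · rw [← not_lt, ← not_lt, add_lt_add_iff_right, sub_lt_sub_iff_right, h2]
      omega
  have hpos : ∀ h : Fin (2 * n), 0 < hoursUntil (2 * n) r (h + 1) := by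
    intro h
    unfold hoursUntil
    split_ifs <;> omega
  have p0 := hpos (σ (i, 0))
  have p1 := hpos (σ (i, 1))
  rw [nextTime_markingOf σ i hr ht]
  unfold firstFrom
  by_cases h : Int.fract (u (i, 0) - a) ≤ Int.fract (u (i, 1) - a)
  · refine ⟨(i, 0), rfl, by rw [if_pos h], by omega, ?_⟩
    rw [min_eq_left (key.1 h)]
    exact modEq_add_hoursUntil hr ht
  · refine ⟨(i, 1), rfl, by rw [if_neg h], by omega, ?_⟩
    rw [min_eq_right (not_le.1 fun h' => h (key.2 h')).le]
    exact modEq_add_hoursUntil hr ht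

theorem IsRanking.card_le {n : ℕ} {σ : Fin n × Fin 2 ≃ Fin (2 * n)} {u : Fin n × Fin 2 → ℝ}
    (hu : IsRanking σ u) (q : Fin n × Fin 2) :
    (Finset.univ.filter fun q' => u q' ≤ u q).card = σ q + 1 := by
  have : (Finset.univ.filter fun q' => u q' ≤ u q) = (Finset.Iic (σ q)).map σ.symm.toEmbedding := by
    ext q'
    have := hu.2 q q'
    simp only [Finset.mem_filter, Finset.mem_univ, true_and, Finset.mem_map_equiv, Equiv.symm_symm,
      Finset.mem_Iic]
    rw [← not_lt, this, not_lt]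
  rw [this, Finset.card_map, Fin.card_Iic]

/-- The walk on the circle and the walk on the hours that are the ranks end at the same point. -/
theorem IsRanking.exists_final {n : ℕ} (hn : 0 < n) {σ : Fin n × Fin 2 ≃ Fin (2 * n)}
    {u : Fin n × Fin 2 → ℝ} (hu : IsRanking σ u) :
    ∃ q, finalPosition u = u q ∧ finalHour (markingOf σ) = σ q + 1 := by
  -- The clause `(q.1 : ℕ) + 1 = m` records the pair just used: the next pair is a different one, so
  -- its points differ from the current position.
  have h := foldl_invariant (fun m (a : ℝ) (t : ℕ) => (m = 0 ∧ a = 0 ∧ t = 0) ∨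
      ∃ q : Fin n × Fin 2, (q.1 : ℕ) + 1 = m ∧ a = u q ∧ 0 < t ∧ t ≡ σ q + 1 [MOD 2 * n])
    (fun a i => firstFrom a (u (i, 0)) (u (i, 1))) (fun t i => nextTime (markingOf σ) t i)
    (0 : ℝ) 0 (Or.inl ⟨rfl, rfl, rfl⟩) ?_
  · rcases h with h | ⟨q, -, h1, h2, h3⟩
    · omega
    · refine ⟨q, h1, ?_⟩
      change 0 < finalTime (markingOf σ) at h2
      change finalTime (markingOf σ) ≡ _ [MOD 2 * n] at h3
      unfold finalHour
      obtain ⟨T, hT⟩ := Nat.exists_eq_add_of_lt h2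
      rw [hT] at h3 ⊢
      have h4 : 0 + T ≡ σ q [MOD 2 * n] := Nat.ModEq.add_right_cancel' 1 h3
      rw [Nat.add_sub_cancel, h4, Nat.mod_eq_of_lt (σ q).2]
  · intro i a t h
    right
    have : ∃ q : Fin n × Fin 2, q.1 = i ∧ firstFrom a (u (i, 0)) (u (i, 1)) = u q ∧
      0 < nextTime (markingOf σ) t i ∧ nextTime (markingOf σ) t i ≡ σ q + 1 [MOD 2 * n] := by
      rcases h with ⟨-, rfl, rfl⟩ | ⟨q, h1, rfl, h2, h3⟩
      · exact firstFrom_nextTime hu i le_rfl one_pos (Nat.zero_le _) rfl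
          (fun e => (hu.1 _).1.ne') fun e => ⟨fun _ => (hu.1 _).1, fun _ => Nat.succ_pos _⟩
      · refine firstFrom_nextTime hu i (hu.1 q).1.le (hu.1 q).2 (by omega) h3 ?_ ?_
        · intro e he
          have h4 : σ (i, e) = σ q :=
            le_antisymm (not_lt.1 fun h => ((hu.2 _ _).2 h).ne' he)
              (not_lt.1 fun h => ((hu.2 _ _).2 h).ne he)
          have h5 := σ.injective h4
          rw [← h5] at h1
          simp at h1
        · intro e
          rw [hu.2, Fin.lt_def]
          omega
    obtain ⟨q, hq, h1, h2, h3⟩ := this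
    exact ⟨q, by rw [hq], h1, h2, h3⟩

theorem IsRanking.finalIndex_eq {n : ℕ} (hn : 0 < n) {σ : Fin n × Fin 2 ≃ Fin (2 * n)}
    {u : Fin n × Fin 2 → ℝ} (hu : IsRanking σ u) : finalIndex u = finalHour (markingOf σ) := by
  obtain ⟨q, h1, h2⟩ := hu.exists_final hn
  rw [finalIndex, h1, hu.card_le, h2]

theorem exists_equiv_fin_lt_iff {α : Type*} [Fintype α] {k : ℕ} (hk : Fintype.card α = k)
    {u : α → ℝ} (hu : Function.Injective u) : ∃ σ : α ≃ Fin k, ∀ q q', u q < u q' ↔ σ q < σ q' := by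
  let _ : LinearOrder α := LinearOrder.lift' u hu
  let e := Fintype.orderIsoFinOfCardEq α hk
  exact ⟨e.symm.toEquiv, fun q q' => (e.symm.lt_iff_lt (x := q) (y := q')).symm⟩

theorem exists_isRanking {n : ℕ} {u : Fin n × Fin 2 → ℝ} (h1 : ∀ q, u q ∈ Set.Ioo (0 : ℝ) 1)
    (h2 : Function.Injective u) : ∃ σ, IsRanking σ u := by
  obtain ⟨σ, hσ⟩ := exists_equiv_fin_lt_iff (k := 2 * n) (by simp [mul_comm]) h2
  exact ⟨σ, h1, hσ⟩

theorem IsRanking.unique {n : ℕ} {σ σ' : Fin n × Fin 2 ≃ Fin (2 * n)} {u : Fin n × Fin 2 → ℝ}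
    (h : IsRanking σ u) (h' : IsRanking σ' u) : σ = σ' := by
  ext q
  have := h.card_le q
  have := h'.card_le q
  omega

/-! ### Counting the markings -/

/-- Both markings use each mark twice, so a permutation `π` of the hours carries one to the other,
and composition with `π` matches the fibres. Their common size (`2^n`) is never needed. -/
theorem card_fiber_markingOf {n : ℕ} (τ τ' : Marking n) :
    Nat.card {σ : Fin n × Fin 2 ≃ Fin (2 * n) // markingOf σ = τ.1} =
      Nat.card {σ : Fin n × Fin 2 ≃ Fin (2 * n) // markingOf σ = τ'.1} := by
  have h : ∀ i, {h // τ.1 h = i} ≃ {h // τ'.1 h = i} := fun i =>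
    Fintype.equivOfCardEq (by rw [Fintype.card_subtype, Fintype.card_subtype, τ.2, τ'.2])
  let π := Equiv.ofFiberEquiv h
  have hπ : ∀ x, τ'.1 (π x) = τ.1 x := Equiv.ofFiberEquiv_map h
  refine Nat.card_congr (Equiv.subtypeEquiv
    ⟨fun σ => σ.trans π, fun σ => σ.trans π.symm, fun σ => by ext; simp, fun σ => by ext; simp⟩
    fun σ => ?_)
  simp only [funext_iff, Equiv.coe_fn_mk]
  rw [π.surjective.forall (p := fun x => markingOf (σ.trans π) x = τ'.1 x)]
  simp [markingOf, hπ]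

theorem card_subtype_comp_eq_mul {α β : Type*} [Finite α] [Finite β] (F : α → β) (M : ℕ)
    (hF : ∀ b, Nat.card {a // F a = b} = M) (P : β → Prop) :
    Nat.card {a // P (F a)} = M * Nat.card {b // P b} := by
  have e : {a // P (F a)} ≃ Σ b : {b // P b}, {a // F a = b.1} :=
    ⟨fun a => ⟨⟨F a.1, a.2⟩, ⟨a.1, rfl⟩⟩, fun x => ⟨x.2.1, by rw [x.2.2]; exact x.1.2⟩,
      fun a => rfl, by rintro ⟨⟨b, hb⟩, ⟨a, h : F a = b⟩⟩; subst h; rfl⟩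
  have := Fintype.ofFinite {b // P b}
  rw [Nat.card_congr e, Nat.card_sigma, Finset.sum_congr rfl fun b _ => hF b.1, Finset.sum_const,
    Finset.card_univ, smul_eq_mul, mul_comm, Nat.card_eq_fintype_card]

/-- The probability `p k n` as a proportion of rankings. -/
theorem p_eq_card_ranking (k n : ℕ) :
    p k n = (Nat.card {σ : Fin n × Fin 2 ≃ Fin (2 * n) // finalHour (markingOf σ) = k} : ℝ) /
      ((2 * n)! : ℝ) := by
  have : Finite (Marking n) := inferInstanceAs (Finite {τ : Fin (2 * n) → Fin n // _})
  let σ₀ : Fin n × Fin 2 ≃ Fin (2 * n) := Fintype.equivOfCardEq (by simp [mul_comm])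
  let F : (Fin n × Fin 2 ≃ Fin (2 * n)) → Marking n :=
    fun σ => ⟨markingOf σ, card_filter_markingOf σ⟩
  set M := Nat.card {σ : Fin n × Fin 2 ≃ Fin (2 * n) // markingOf σ = (F σ₀).1}
  have hF : ∀ τ, Nat.card {σ // F σ = τ} = M := fun τ => by
    rw [show M = _ from card_fiber_markingOf (F σ₀) τ]
    exact Nat.card_congr (Equiv.subtypeEquivRight fun σ => Subtype.ext_iff)
  have h1 : Nat.card {σ : Fin n × Fin 2 ≃ Fin (2 * n) // finalHour (markingOf σ) = k} =
      M * Nat.card {τ : Marking n // finalHour τ.1 = k} :=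
    card_subtype_comp_eq_mul F M hF fun τ => finalHour τ.1 = k
  have h2 : (2 * n)! = M * Nat.card (Marking n) := by
    have h3 := card_subtype_comp_eq_mul F M hF fun _ => True
    rw [Nat.card_congr (Equiv.subtypeUnivEquiv fun _ => trivial),
      Nat.card_congr (Equiv.subtypeUnivEquiv fun _ => trivial), Nat.card_eq_fintype_card,
      Fintype.card_equiv σ₀] at h3
    simpa [mul_comm] using h3
  have h4 : (M : ℝ) ≠ 0 := by
    intro h
    have := Nat.factorial_ne_zero (2 * n)
    rw [h2, Nat.cast_eq_zero.1 h, zero_mul] at this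
    exact this rfl
  rw [p, h1, h2]
  push_cast
  rw [mul_div_mul_left _ _ h4]

/-! ### Exchangeability of independent uniform points -/

/-- The uniform distribution on `[0, 1)`. -/
noncomputable def unif : Measure ℝ := volume.restrict (Set.Ico (0 : ℝ) 1)

instance : IsProbabilityMeasure unif := ⟨by simp [unif]⟩

instance : NullSingletonClass unif :=
  inferInstanceAs (NullSingletonClass (volume.restrict (Set.Ico (0 : ℝ) 1)))

theorem ae_unif_mem_Ioo : ∀ᵐ x ∂unif, x ∈ Set.Ioo (0 : ℝ) 1 := by
  rw [unif, ← Measure.restrict_congr_set (Ioo_ae_eq_Ico (μ := volume))]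
  exact ae_restrict_mem measurableSet_Ioo

/-- The law of `2n` independent uniform points. -/
noncomputable def cube (n : ℕ) : Measure (Fin n × Fin 2 → ℝ) := Measure.pi fun _ => unif

instance (n : ℕ) : IsProbabilityMeasure (cube n) :=
  inferInstanceAs (IsProbabilityMeasure (Measure.pi fun _ : Fin n × Fin 2 => unif))

theorem iIndepFun_cube (n : ℕ) : iIndepFun (fun q (u : Fin n × Fin 2 → ℝ) => u q) (cube n) :=
  iIndepFun_pi (X := fun _ => id) fun _ => aemeasurable_id

theorem map_eval_cube {n : ℕ} (q : Fin n × Fin 2) : (cube n).map (fun u => u q) = unif :=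
  (measurePreserving_eval (fun _ : Fin n × Fin 2 => unif) q).map_eq

theorem ae_cube_ne {n : ℕ} {q q' : Fin n × Fin 2} (h : q ≠ q') : ∀ᵐ u ∂cube n, u q ≠ u q' := by
  have h1 := (iIndepFun_cube n).indepFun h
  rw [indepFun_iff_map_prod_eq_prod_map_map (measurable_pi_apply q).aemeasurable
    (measurable_pi_apply q').aemeasurable, map_eval_cube,
    map_eval_cube] at h1
  have h2 : ∀ᵐ z ∂(unif.prod unif), z.1 ≠ z.2 := by
    have hm : MeasurableSet {z : ℝ × ℝ | z.1 ≠ z.2} :=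
      (measurableSet_eq_fun measurable_fst measurable_snd).compl
    rw [Measure.ae_prod_iff_ae_ae hm]
    refine Filter.Eventually.of_forall fun x => ?_
    filter_upwards [Measure.ae_ne unif x] with y hy using hy.symm
  rw [← h1] at h2
  exact ae_of_ae_map ((measurable_pi_apply q).prodMk (measurable_pi_apply q')).aemeasurable h2

theorem ae_cube_exists_isRanking (n : ℕ) : ∀ᵐ u ∂cube n, ∃ σ, IsRanking σ u := by
  have h1 : ∀ᵐ u ∂cube n, ∀ q, u q ∈ Set.Ioo (0 : ℝ) 1 := by
    rw [ae_all_iff]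
    intro q
    have := ae_unif_mem_Ioo
    rw [← map_eval_cube q] at this
    exact ae_of_ae_map (measurable_pi_apply q).aemeasurable this
  have h2 : ∀ᵐ u ∂cube n, ∀ q q', q ≠ q' → u q ≠ u q' := by
    simp only [ae_all_iff]
    exact fun q q' h => ae_cube_ne h
  filter_upwards [h1, h2] with u h1 h2
  exact exists_isRanking h1 fun q q' h => by_contra fun hne => h2 q q' hne h

theorem measurableSet_isRanking {n : ℕ} (σ : Fin n × Fin 2 ≃ Fin (2 * n)) :
    MeasurableSet {u | IsRanking σ u} := by
  unfold IsRanking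
  simp only [Set.ofPred_and, Set.ofPred_forall]
  refine (MeasurableSet.iInter fun q => measurableSet_Ioo.preimage (by fun_prop)).inter
    (MeasurableSet.iInter fun q => MeasurableSet.iInter fun q' => ?_)
  by_cases h : σ q < σ q'
  · simpa [h] using measurableSet_lt (measurable_pi_apply q) (measurable_pi_apply q')
  · simpa [h] using measurableSet_le (measurable_pi_apply q') (measurable_pi_apply q)

theorem measurePreserving_comp_perm {n : ℕ} (e : Equiv.Perm (Fin n × Fin 2)) :
    MeasurePreserving (fun u : Fin n × Fin 2 → ℝ => u ∘ e) (cube n) (cube n) := by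
  unfold cube
  convert measurePreserving_piCongrLeft (fun _ : Fin n × Fin 2 => unif) e.symm using 1
  ext u q
  obtain ⟨q, rfl⟩ := e.symm.surjective q
  rw [MeasurableEquiv.coe_piCongrLeft, Equiv.piCongrLeft_apply_apply]
  simp

/-- All the rankings are equally likely, even given a symmetric event. -/
theorem cube_isRanking_inter {n : ℕ} {W : Set (Fin n × Fin 2 → ℝ)} (hW : MeasurableSet W)
    (hsymm : ∀ (e : Equiv.Perm (Fin n × Fin 2)) u, u ∘ e ∈ W ↔ u ∈ W)
    (σ : Fin n × Fin 2 ≃ Fin (2 * n)) :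
    (cube n).real ({u | IsRanking σ u} ∩ W) = (cube n).real W / ((2 * n)! : ℝ) := by
  have h1 : ∀ σ' : Fin n × Fin 2 ≃ Fin (2 * n), (cube n).real ({u | IsRanking σ' u} ∩ W) =
      (cube n).real ({u | IsRanking σ u} ∩ W) := by
    intro σ'
    -- Since `σ' ∘ e = σ`, the vector `u ∘ e` has ranking `σ` exactly when `u` has ranking `σ'`.
    let e : Equiv.Perm (Fin n × Fin 2) := σ.trans σ'.symm
    have h2 := (measurePreserving_comp_perm e).measureReal_preimage
      ((measurableSet_isRanking σ).inter hW).nullMeasurableSet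
    rw [← h2]
    congr 1
    ext u
    simp only [Set.mem_inter_iff, Set.mem_ofPred_eq, Set.mem_preimage, hsymm, and_congr_left_iff]
    intro _
    unfold IsRanking
    rw [e.surjective.forall (p := fun q => u q ∈ Set.Ioo (0 : ℝ) 1),
      e.surjective.forall (p := fun q => ∀ q', u q < u q' ↔ σ' q < σ' q')]
    refine and_congr Iff.rfl (forall_congr' fun q => ?_)
    rw [e.surjective.forall]
    simp [e]
  have h3 : (cube n).real W = ∑ σ' : Fin n × Fin 2 ≃ Fin (2 * n),
      (cube n).real ({u | IsRanking σ' u} ∩ W) := by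
    rw [← measureReal_iUnion_fintype]
    · apply measureReal_congr
      filter_upwards [ae_cube_exists_isRanking n] with u hu
      refine propext ⟨fun h => ?_, fun h => ?_⟩
      · obtain ⟨σ', h'⟩ := hu
        exact Set.mem_iUnion.2 ⟨σ', h', h⟩
      · obtain ⟨σ', h'⟩ := Set.mem_iUnion.1 h
        exact h'.2
    · intro σ₁ σ₂ hne
      refine Set.disjoint_left.2 fun u h h' => hne (IsRanking.unique h.1 h'.1)
    · exact fun σ' => (measurableSet_isRanking σ').inter hW
  rw [h3, Finset.sum_congr rfl fun σ' _ => h1 σ', Finset.sum_const, Finset.card_univ,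
    Fintype.card_equiv σ]
  have : ((2 * n)! : ℝ) ≠ 0 := by positivity
  simp [mul_comm n 2, this]

/-- Independence of the ranking from the order statistics, the latter represented by symmetric
events. `W = univ` gives the law of the index; events about the number of points below `c` give the
law of the end. -/
theorem cube_finalIndex_inter {n : ℕ} (hn : 0 < n) {W : Set (Fin n × Fin 2 → ℝ)}
    (hW : MeasurableSet W) (hsymm : ∀ (e : Equiv.Perm (Fin n × Fin 2)) u, u ∘ e ∈ W ↔ u ∈ W)
    (k : ℕ) : (cube n).real ({u | finalIndex u = k} ∩ W) = p k n * (cube n).real W := by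
  classical
  let S : Finset (Fin n × Fin 2 ≃ Fin (2 * n)) :=
    Finset.univ.filter fun σ => finalHour (markingOf σ) = k
  have h1 : (cube n).real ({u | finalIndex u = k} ∩ W) =
      (cube n).real (⋃ σ ∈ S, {u | IsRanking σ u} ∩ W) := by
    apply measureReal_congr
    filter_upwards [ae_cube_exists_isRanking n] with u ⟨σ, hu⟩
    refine propext ⟨fun h => ?_, fun h => ?_⟩
    · refine Set.mem_iUnion₂.2 ⟨σ, ?_, hu, h.2⟩
      simpa [S] using (hu.finalIndex_eq hn).symm.trans h.1
    · obtain ⟨σ', hσ', h'⟩ := Set.mem_iUnion₂.1 h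
      exact ⟨(IsRanking.finalIndex_eq hn h'.1).trans (by simpa [S] using hσ'), h'.2⟩
  rw [h1, measureReal_biUnion_finset, Finset.sum_congr rfl fun σ _ => cube_isRanking_inter hW hsymm σ,
    Finset.sum_const, p_eq_card_ranking, Nat.card_eq_fintype_card, Fintype.card_subtype,
    nsmul_eq_mul]
  · ring
  · intro σ₁ _ σ₂ _ hne
    exact Set.disjoint_left.2 fun u h h' => hne (IsRanking.unique h.1 h'.1)
  · exact fun σ _ => (measurableSet_isRanking σ).inter hW

/-! ### Measurability of the walk -/

theorem measurable_firstFrom : Measurable fun z : ℝ × ℝ × ℝ => firstFrom z.1 z.2.1 z.2.2 := by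
  unfold firstFrom
  exact Measurable.ite (measurableSet_le (by fun_prop) (by fun_prop)) (by fun_prop) (by fun_prop)

theorem finalPosition_succ {n : ℕ} (u : Fin (n + 1) × Fin 2 → ℝ) :
    finalPosition u = firstFrom (finalPosition fun q : Fin n × Fin 2 => u (q.1.castSucc, q.2))
      (u (Fin.last n, 0)) (u (Fin.last n, 1)) := by
  simp only [finalPosition, Fin.foldl_succ_last]

theorem measurable_finalPosition (n : ℕ) :
    Measurable (finalPosition : (Fin n × Fin 2 → ℝ) → ℝ) := by
  induction n with
  | zero =>
    have : (finalPosition : (Fin 0 × Fin 2 → ℝ) → ℝ) = fun _ => 0 := by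
      ext u
      simp [finalPosition]
    rw [this]
    exact measurable_const
  | succ n ih =>
    simp only [funext finalPosition_succ]
    have : Measurable fun u : Fin (n + 1) × Fin 2 → ℝ =>
        finalPosition fun q : Fin n × Fin 2 => u (q.1.castSucc, q.2) :=
      ih.comp (measurable_pi_lambda _ fun q => measurable_pi_apply _)
    exact measurable_firstFrom.comp
      (this.prodMk ((measurable_pi_apply _).prodMk (measurable_pi_apply _)))

theorem measurable_card_le {n : ℕ} {g : (Fin n × Fin 2 → ℝ) → ℝ} (hg : Measurable g) :
    Measurable fun u : Fin n × Fin 2 → ℝ => (Finset.univ.filter fun q => u q ≤ g u).card := by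
  simp only [Finset.card_filter]
  refine Finset.measurable_sum _ fun q _ => ?_
  exact Measurable.ite (measurableSet_le (measurable_pi_apply q) hg) measurable_const
    measurable_const

theorem measurable_finalIndex (n : ℕ) : Measurable (finalIndex : (Fin n × Fin 2 → ℝ) → ℕ) :=
  measurable_card_le (measurable_finalPosition n)

/-- The index of the end of the walk on the circle has the law of the end of the walk on the
hours. -/
theorem measureReal_finalIndex_eq {n : ℕ} (hn : 0 < n) {Ω : Type*} [MeasurableSpace Ω]
    (μ : Measure Ω) [IsProbabilityMeasure μ] (U : Fin n × Fin 2 → Ω → ℝ)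
    (hU : ∀ q, Measurable (U q)) (hlaw : ∀ q, μ.map (U q) = unif) (hind : iIndepFun U μ) (k : ℕ) :
    μ.real {ω | finalIndex (fun q => U q ω) = k} = p k n := by
  have h1 : μ.map (fun ω q => U q ω) = cube n := by
    rw [hind.map_fun_eq_pi_map fun q => (hU q).aemeasurable]
    simp only [hlaw, cube]
  have h2 := cube_finalIndex_inter hn MeasurableSet.univ (by simp) k
  have h3 : MeasurableSet {u : Fin n × Fin 2 → ℝ | finalIndex u = k} :=
    measurable_finalIndex n (measurableSet_singleton k)
  rw [Set.inter_univ, probReal_univ, mul_one, ← h1,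
    map_measureReal_apply (measurable_pi_lambda _ hU) h3] at h2
  exact h2

/-! ### The number of points before a given position -/

/-- A binomial law: the event splits according to the set `S` of points in `Iic c`, each choice of
`S` being a product event. -/
theorem cube_real_card_le_eq (n j : ℕ) {c : ℝ} (hc : c ∈ Set.Icc (0 : ℝ) 1) :
    (cube n).real {u | (Finset.univ.filter fun q => u q ≤ c).card = j} =
      (2 * n).choose j * c ^ j * (1 - c) ^ (2 * n - j) := by
  classical
  have hI : unif.real (Set.Iic c) = c := by
    have : (Set.Iic c ∩ Set.Ioo 0 1 : Set ℝ) =ᵐ[volume] Set.Ioo 0 c := by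
      filter_upwards [Measure.ae_ne volume c] with x hx
      refine propext ⟨fun h => ⟨h.2.1, lt_of_le_of_ne h.1 hx⟩, fun h => ⟨h.2.le, h.1, ?_⟩⟩
      exact h.2.trans_le hc.2
    rw [unif, ← Measure.restrict_congr_set (Ioo_ae_eq_Ico (μ := volume)),
      measureReal_restrict_apply measurableSet_Iic, measureReal_congr this]
    simp [hc.1]
  have hI' : unif.real (Set.Ioi c) = 1 - c := by
    rw [← Set.compl_Iic, probReal_compl_eq_one_sub measurableSet_Iic, hI]
  have h1 : {u : Fin n × Fin 2 → ℝ | (Finset.univ.filter fun q => u q ≤ c).card = j} =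
      ⋃ S ∈ Finset.powersetCard j (Finset.univ : Finset (Fin n × Fin 2)),
        Set.univ.pi fun q => if q ∈ S then Set.Iic c else Set.Ioi c := by
    ext u
    simp only [Set.mem_ofPred_eq, Set.mem_iUnion, Finset.mem_powersetCard, Finset.subset_univ,
      true_and, Set.mem_univ_pi, exists_prop]
    refine ⟨fun h => ⟨_, h, fun q => ?_⟩, ?_⟩
    · split_ifs with hq <;> simpa using hq
    · rintro ⟨S, rfl, hS⟩
      congr 1
      ext q
      have := hS q
      split_ifs at this with hq
      · simpa [hq] using this
      · simpa [hq] using this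
  rw [h1, measureReal_biUnion_finset]
  · have h2 : ∀ S ∈ Finset.powersetCard j (Finset.univ : Finset (Fin n × Fin 2)),
        (cube n).real (Set.univ.pi fun q => if q ∈ S then Set.Iic c else Set.Ioi c) =
          c ^ j * (1 - c) ^ (2 * n - j) := by
      intro S hS
      rw [Finset.mem_powersetCard] at hS
      rw [measureReal_def, cube, Measure.pi_pi, ENNReal.toReal_prod]
      simp only [← measureReal_def, apply_ite unif.real, hI, hI']
      rw [Finset.prod_ite, Finset.prod_const, Finset.prod_const]
      have h3 : (Finset.univ.filter fun q => q ∈ S) = S := by simp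
      have h4 : (Finset.univ.filter fun q => q ∉ S) = Sᶜ := by ext; simp
      rw [h3, h4, Finset.card_compl, hS.2]
      simp [mul_comm n 2]
    rw [Finset.sum_congr rfl h2, Finset.sum_const, Finset.card_powersetCard, nsmul_eq_mul]
    simp [mul_comm n 2, mul_assoc]
  · intro S _ T _ hne
    refine Set.disjoint_left.2 fun u hS hT => hne ?_
    ext q
    have h3 := hS q trivial
    have h4 := hT q trivial
    by_cases hq : q ∈ S <;> by_cases hq' : q ∈ T <;> simp_all
    all_goals linarith
  · intro S _
    refine MeasurableSet.univ_pi fun q => ?_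
    split_ifs
    exacts [measurableSet_Iic, measurableSet_Ioi]

/-- The distribution function of the end of the walk in terms of the law of its index. -/
theorem cube_real_finalPosition_le {n : ℕ} (hn : 0 < n) {c : ℝ} (hc : c ∈ Set.Icc (0 : ℝ) 1) :
    (cube n).real {u | finalPosition u ≤ c} = ∑ k ∈ Finset.Icc 1 (2 * n), p k n *
      ∑ j ∈ Finset.Icc k (2 * n), (2 * n).choose j * c ^ j * (1 - c) ^ (2 * n - j) := by
  have hm := measurable_card_le (n := n) (measurable_const (a := c))
  -- The end is the `k`-th smallest point, with `k` its index, so it is at most `c` iff at least `k`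
  -- points are. The latter event is symmetric.
  have h1 : (cube n).real {u | finalPosition u ≤ c} = (cube n).real
      (⋃ k ∈ Finset.Icc 1 (2 * n), {u | finalIndex u = k} ∩
        {u | (Finset.univ.filter fun q => u q ≤ c).card ∈ Finset.Icc k (2 * n)}) := by
    apply measureReal_congr
    filter_upwards [ae_cube_exists_isRanking n] with u ⟨σ, hu⟩
    obtain ⟨q, hq, -⟩ := hu.exists_final hn
    have hi : finalIndex u = σ q + 1 := by rw [finalIndex, hq, hu.card_le]
    have hle : (Finset.univ.filter fun q => u q ≤ c).card ≤ 2 * n := by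
      refine (Finset.card_le_univ _).trans_eq (by simp [mul_comm])
    refine propext ⟨fun h => ?_, fun h => ?_⟩
    · change finalPosition u ≤ c at h
      refine Set.mem_iUnion₂.2 ⟨finalIndex u, ?_, rfl, ?_⟩
      · rw [Finset.mem_Icc, hi]
        omega
      · refine Finset.mem_Icc.2 ⟨Finset.card_le_card fun q' hq' => ?_, hle⟩
        simp only [Finset.mem_filter, Finset.mem_univ, true_and] at hq' ⊢
        exact hq'.trans h
    · obtain ⟨k, -, hk, h⟩ := Set.mem_iUnion₂.1 h
      change finalIndex u = k at hk
      change finalPosition u ≤ c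
      replace h := (Finset.mem_Icc.1 (show _ ∈ Finset.Icc k (2 * n) from h)).1
      by_contra hlt
      push Not at hlt
      have : (Finset.univ.filter fun q => u q ≤ c) ⊂
          Finset.univ.filter fun q => u q ≤ finalPosition u := by
        refine Finset.ssubset_iff_subset_ne.2 ⟨fun q' hq' => ?_, fun heq => ?_⟩
        · simp only [Finset.mem_filter, Finset.mem_univ, true_and] at hq' ⊢
          exact hq'.trans hlt.le
        · have : q ∈ Finset.univ.filter fun q => u q ≤ c := by
            rw [heq]
            simp [hq]
          simp only [Finset.mem_filter, Finset.mem_univ, true_and] at this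
          linarith
      have := Finset.card_lt_card this
      change _ < finalIndex u at this
      omega
  rw [h1, measureReal_biUnion_finset]
  · refine Finset.sum_congr rfl fun k _ => ?_
    rw [cube_finalIndex_inter hn]
    · congr 1
      rw [← Finset.sum_congr rfl fun j _ => cube_real_card_le_eq n j hc,
        ← measureReal_biUnion_finset]
      · congr 1
        ext u
        simp
      · intro i _ j _ hne
        exact Set.disjoint_left.2 fun u h h' => hne (Eq.trans (Eq.symm h) h')
      · exact fun j _ => hm (measurableSet_singleton j)
    · exact hm (Finset.measurableSet _)
    · intro e u
      have : (Finset.univ.filter fun q => (u ∘ e) q ≤ c).card =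
          (Finset.univ.filter fun q => u q ≤ c).card :=
        Finset.card_equiv e (by simp)
      simp only [Set.mem_ofPred_eq, this]
  · intro i _ j _ hne
    exact Set.disjoint_left.2 fun u h h' => hne (Eq.trans (Eq.symm h.1) h'.1)
  · exact fun k _ => (measurable_finalIndex n (measurableSet_singleton k)).inter
      (hm (Finset.measurableSet _))

/-! ### One step of the walk on the circle -/

theorem measurable_fract_sub (a : ℝ) : Measurable fun y : ℝ => Int.fract (y - a) := by fun_prop

/-- Rotation invariance: these points form an arc of length `1 - t` ending at `a`. The two cases
tell whether it is cut at `0`. -/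
theorem unif_le_fract_sub {a t : ℝ} (ha : a ∈ Set.Ico (0 : ℝ) 1) (ht : t ∈ Set.Ico (0 : ℝ) 1) :
    unif {y | t ≤ Int.fract (y - a)} = ENNReal.ofReal (1 - t) := by
  have hm : MeasurableSet {y : ℝ | t ≤ Int.fract (y - a)} :=
    measurableSet_le measurable_const (measurable_fract_sub a)
  rw [unif, Measure.restrict_apply hm]
  obtain ⟨ha0, ha1⟩ := ha
  obtain ⟨ht0, ht1⟩ := ht
  rcases le_or_gt (a + t) 1 with h | h
  · have : {y : ℝ | t ≤ Int.fract (y - a)} ∩ Set.Ico 0 1 = Set.Ico (a + t) 1 ∪ Set.Ico 0 a := by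
      ext y
      simp only [Set.mem_inter_iff, Set.mem_ofPred_eq, Set.mem_Ico, Set.mem_union]
      constructor
      · rintro ⟨h1, h2, h3⟩
        rw [fract_sub_of_mem ha0 ha1 h2 h3] at h1
        split_ifs at h1 with h4
        · exact Or.inl ⟨by linarith, h3⟩
        · exact Or.inr ⟨h2, not_le.1 h4⟩
      · intro h1
        have h2 : 0 ≤ y ∧ y < 1 := by rcases h1 with h1 | h1 <;> constructor <;> linarith
        refine ⟨?_, h2⟩
        rw [fract_sub_of_mem ha0 ha1 h2.1 h2.2]
        split_ifs with h4 <;> rcases h1 with h1 | h1 <;> linarith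
    rw [this, measure_union _ measurableSet_Ico, Real.volume_Ico, Real.volume_Ico,
      ← ENNReal.ofReal_add (by linarith) (by linarith)]
    · congr 1
      ring
    · exact Set.disjoint_left.2 fun y h1 h2 => by linarith [h1.1, h2.2]
  · have : {y : ℝ | t ≤ Int.fract (y - a)} ∩ Set.Ico 0 1 = Set.Ico (a + t - 1) a := by
      ext y
      simp only [Set.mem_inter_iff, Set.mem_ofPred_eq, Set.mem_Ico]
      constructor
      · rintro ⟨h1, h2, h3⟩
        rw [fract_sub_of_mem ha0 ha1 h2 h3] at h1
        split_ifs at h1 with h4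
        · linarith
        · exact ⟨by linarith, not_le.1 h4⟩
      · intro h1
        have h2 : 0 ≤ y ∧ y < 1 := by constructor <;> linarith
        refine ⟨?_, h2⟩
        rw [fract_sub_of_mem ha0 ha1 h2.1 h2.2]
        split_ifs with h4 <;> linarith
    rw [this, Real.volume_Ico]
    congr 1
    ring

theorem unif_lt_fract_sub {a t : ℝ} (ha : a ∈ Set.Ico (0 : ℝ) 1) (ht : t ∈ Set.Ico (0 : ℝ) 1) :
    unif {y | t < Int.fract (y - a)} = ENNReal.ofReal (1 - t) := by
  rw [← unif_le_fract_sub ha ht]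
  apply measure_congr
  have h1 : ∀ᵐ y ∂unif, y ∈ Set.Ioo (0 : ℝ) 1 := ae_unif_mem_Ioo
  filter_upwards [h1, Measure.ae_ne unif (a + t), Measure.ae_ne unif (a + t - 1)] with y h1 h2 h3
  refine propext (Ne.le_iff_lt fun h => ?_ : t ≤ Int.fract (y - a) ↔ t < Int.fract (y - a)).symm
  rw [fract_sub_of_mem ha.1 ha.2 h1.1.le h1.2] at h
  split_ifs at h
  · exact h2 (by linarith)
  · exact h3 (by linarith)

/-- The density at `v` of the first of two uniform points on the way from `a`. -/
noncomputable def stepDensity (a v : ℝ) : ENNReal := ENNReal.ofReal (2 * (1 - Int.fract (v - a)))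

theorem measurable_stepDensity : Measurable (Function.uncurry stepDensity) := by
  unfold stepDensity Function.uncurry
  fun_prop

/-- Either point may come first; the other must then lie farther from `a`, with probability `1 -
Int.fract (v - a)`. The two contributions give the factor `2`. -/
theorem prod_unif_firstFrom {a : ℝ} (ha : a ∈ Set.Ico (0 : ℝ) 1) {s : Set ℝ}
    (hs : MeasurableSet s) :
    (unif.prod unif) {z | firstFrom a z.1 z.2 ∈ s} = ∫⁻ v in s, stepDensity a v ∂unif := by
  have hF := measurable_fract_sub a
  have hA : MeasurableSet {z : ℝ × ℝ | z.1 ∈ s ∧ Int.fract (z.1 - a) ≤ Int.fract (z.2 - a)} :=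
    (hs.preimage measurable_fst).inter
      (measurableSet_le (hF.comp measurable_fst) (hF.comp measurable_snd))
  have hB : MeasurableSet {z : ℝ × ℝ | z.2 ∈ s ∧ Int.fract (z.2 - a) < Int.fract (z.1 - a)} :=
    (hs.preimage measurable_snd).inter
      (measurableSet_lt (hF.comp measurable_snd) (hF.comp measurable_fst))
  have h1 : {z : ℝ × ℝ | firstFrom a z.1 z.2 ∈ s} =
      {z : ℝ × ℝ | z.1 ∈ s ∧ Int.fract (z.1 - a) ≤ Int.fract (z.2 - a)} ∪
        {z : ℝ × ℝ | z.2 ∈ s ∧ Int.fract (z.2 - a) < Int.fract (z.1 - a)} := by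
    ext z
    simp only [Set.mem_ofPred_eq, Set.mem_union, firstFrom]
    split_ifs with h
    · simp [h, h.not_gt]
    · simp [h, not_le.1 h]
  have hfr : ∀ v : ℝ, Int.fract (v - a) ∈ Set.Ico (0 : ℝ) 1 :=
    fun v => ⟨Int.fract_nonneg _, Int.fract_lt_one _⟩
  rw [h1, measure_union _ hB, Measure.prod_apply hA, Measure.prod_apply_symm hB,
    ← lintegral_add_right, ← lintegral_indicator hs]
  · refine lintegral_congr fun v => ?_
    by_cases hv : v ∈ s
    · simp only [Set.preimage, Set.mem_ofPred_eq, hv, true_and, Set.indicator_of_mem]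
      change unif {y | Int.fract (v - a) ≤ Int.fract (y - a)} +
        unif {y | Int.fract (v - a) < Int.fract (y - a)} = _
      rw [unif_le_fract_sub ha (hfr v), unif_lt_fract_sub ha (hfr v), stepDensity, two_mul,
        ENNReal.ofReal_add (by linarith [(hfr v).2]) (by linarith [(hfr v).2])]
    · simp [Set.preimage, hv]
  · exact measurable_measure_prodMk_right hB
  · exact Set.disjoint_left.2 fun z h2 h3 => not_le.2 h3.2 h2.2

/-- The walk over the first `n` pairs reads coordinates disjoint from those of the last pair, hence
is independent of it. -/
theorem map_cube_succ (n : ℕ) : (cube (n + 1)).map (fun u =>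
      ((finalPosition fun q : Fin n × Fin 2 => u (q.1.castSucc, q.2)),
        (u (Fin.last n, 0), u (Fin.last n, 1)))) =
    ((cube n).map finalPosition).prod (unif.prod unif) := by
  have hind := iIndepFun_cube (n + 1)
  have hmeas : ∀ q, Measurable fun u : Fin (n + 1) × Fin 2 → ℝ => u q := measurable_pi_apply
  let ι : Fin n × Fin 2 → Fin (n + 1) × Fin 2 := fun q => (q.1.castSucc, q.2)
  have hι : Function.Injective ι := fun q q' h => by
    simpa [ι, Prod.ext_iff] using h
  have h1 : (cube (n + 1)).map (fun u (q : Fin n × Fin 2) => u (ι q)) = cube n := by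
    have h2 := hind.precomp hι
    rw [h2.map_fun_eq_pi_map fun q => (hmeas _).aemeasurable]
    simp only [map_eval_cube]
    rfl
  have hm1 : Measurable fun (u : Fin (n + 1) × Fin 2 → ℝ) (q : Fin n × Fin 2) => u (ι q) :=
    measurable_pi_lambda _ fun q => hmeas _
  have h2 : (cube (n + 1)).map (fun u => (u (Fin.last n, 0), u (Fin.last n, 1))) =
      unif.prod unif := by
    have h3 := hind.indepFun (i := (Fin.last n, 0)) (j := (Fin.last n, 1)) (by simp)
    rwa [indepFun_iff_map_prod_eq_prod_map_map (hmeas _).aemeasurable (hmeas _).aemeasurable,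
      map_eval_cube, map_eval_cube] at h3
  have hm2 : Measurable fun u : Fin (n + 1) × Fin 2 → ℝ =>
      (u (Fin.last n, 0), u (Fin.last n, 1)) := (hmeas _).prodMk (hmeas _)
  let S : Finset (Fin (n + 1) × Fin 2) := Finset.univ.filter fun q => q.1 ≠ Fin.last n
  let T : Finset (Fin (n + 1) × Fin 2) := Finset.univ.filter fun q => q.1 = Fin.last n
  have hST : Disjoint S T := by
    rw [Finset.disjoint_left]
    simp [S, T]
  have h3 := hind.indepFun_finset S T hST hmeas
  have hS : ∀ q, ι q ∈ S := fun q => by simp [S, ι, (Fin.castSucc_lt_last _).ne]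
  have hT : ∀ e, (Fin.last n, e) ∈ T := fun e => by simp [T]
  have hm3 : Measurable fun w : S → ℝ => finalPosition fun q => w ⟨ι q, hS q⟩ :=
    (measurable_finalPosition n).comp (measurable_pi_lambda _ fun q => measurable_pi_apply _)
  have hm4 : Measurable fun w : T → ℝ => (w ⟨_, hT 0⟩, w ⟨_, hT 1⟩) :=
    (measurable_pi_apply _).prodMk (measurable_pi_apply _)
  have h5 : IndepFun (finalPosition ∘ fun (u : Fin (n + 1) × Fin 2 → ℝ) q => u (ι q))
      (fun u => (u (Fin.last n, 0), u (Fin.last n, 1))) (cube (n + 1)) :=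
    h3.comp hm3 hm4
  rw [indepFun_iff_map_prod_eq_prod_map_map
    ((measurable_finalPosition n).comp hm1).aemeasurable hm2.aemeasurable, h2] at h5
  rw [← h1, Measure.map_map (measurable_finalPosition n) hm1]
  exact h5

theorem map_finalPosition_succ {n : ℕ}
    (hn : ∀ᵐ a ∂(cube n).map finalPosition, a ∈ Set.Ico (0 : ℝ) 1) :
    (cube (n + 1)).map finalPosition =
      unif.withDensity fun v => ∫⁻ a, stepDensity a v ∂(cube n).map finalPosition := by
  have : IsProbabilityMeasure ((cube n).map finalPosition) :=
    Measure.isProbabilityMeasure_map (measurable_finalPosition n).aemeasurable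
  have hm1 : Measurable fun (u : Fin (n + 1) × Fin 2 → ℝ) (q : Fin n × Fin 2) =>
      u (q.1.castSucc, q.2) := measurable_pi_lambda _ fun q => measurable_pi_apply _
  have hm2 : Measurable fun u : Fin (n + 1) × Fin 2 → ℝ =>
      ((finalPosition fun q : Fin n × Fin 2 => u (q.1.castSucc, q.2)),
        (u (Fin.last n, 0), u (Fin.last n, 1))) :=
    ((measurable_finalPosition n).comp hm1).prodMk
      ((measurable_pi_apply _).prodMk (measurable_pi_apply _))
  ext s hs
  have h1 : (cube (n + 1)).map finalPosition =
      (((cube n).map finalPosition).prod (unif.prod unif)).map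
        fun z => firstFrom z.1 z.2.1 z.2.2 := by
    rw [← map_cube_succ, Measure.map_map measurable_firstFrom hm2]
    congr 1
    ext u
    exact finalPosition_succ u
  rw [h1, Measure.map_apply measurable_firstFrom hs,
    Measure.prod_apply (measurable_firstFrom hs), withDensity_apply _ hs,
    lintegral_lintegral_swap]
  · refine lintegral_congr_ae ?_
    filter_upwards [hn] with a ha
    exact prod_unif_firstFrom ha hs
  · exact (measurable_stepDensity.comp measurable_swap).aemeasurable

/-! ### Iterating the step -/

theorem hasDerivAt_b_succ (m : ℕ) (x : ℝ) : HasDerivAt (b (m + 1)) (b m x) x := by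
  have h := (hasDerivAt_bernoulliFun (m + 1) x).div_const ((m + 1)! : ℝ)
  have h1 : (m ! : ℝ) ≠ 0 := by positivity
  have h2 : ((m : ℝ) + 1) ≠ 0 := by positivity
  have h3 : ((m + 1 : ℕ) : ℝ) * bernoulliFun (m + 1 - 1) x / ((m + 1)! : ℝ) = b m x := by
    rw [b, Nat.factorial_succ]
    push_cast
    field_simp
  rw [← h3]
  exact h

theorem continuous_b (m : ℕ) : Continuous (b m) :=
  (contDiff_bernoulliFun (k := m)).continuous.div_const _

theorem b_one_eq_b_zero (m : ℕ) : b (m + 2) 1 = b (m + 2) 0 := by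
  rw [b, b, bernoulliFun_endpoints_eq_of_ne_one (by omega)]

/-- The integral over the previous position that gives the density after one more step. -/
theorem intervalIntegral_stepDensity (m : ℕ) {v : ℝ} (hv : v ∈ Set.Icc (0 : ℝ) 1) :
    IntervalIntegrable (fun a => (1 - 2 ^ (m + 1) * b (m + 1) a) * (2 * (1 - Int.fract (v - a))))
        volume 0 1 ∧
      ∫ a in (0 : ℝ)..1, (1 - 2 ^ (m + 1) * b (m + 1) a) * (2 * (1 - Int.fract (v - a))) =
        1 - 2 ^ (m + 2) * b (m + 2) v := by
  obtain ⟨hv0, hv1⟩ := hv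
  set F : ℝ → ℝ := fun a => (1 - 2 ^ (m + 1) * b (m + 1) a) * (2 * (1 - Int.fract (v - a)))
  -- For `a ≤ v` the factor `1 - Int.fract (v - a)` is `s + a` with `s = 1 - v`, for `a > v` with `s
  -- = -v`. `G s` is the primitive of `D s` found by parts.
  let D : ℝ → ℝ → ℝ := fun s a => (1 - 2 ^ (m + 1) * b (m + 1) a) * (2 * (s + a))
  let G : ℝ → ℝ → ℝ := fun s a =>
    2 * (s + a) * (a - 2 ^ (m + 1) * b (m + 2) a) - a ^ 2 + 2 * 2 ^ (m + 1) * b (m + 3) a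
  have hD : ∀ s, Continuous (D s) := fun s => by
    have := continuous_b (m + 1)
    fun_prop
  have hG : ∀ s x, HasDerivAt (G s) (D s x) x := by
    intro s x
    have h1 := hasDerivAt_b_succ (m + 1) x
    have h2 := hasDerivAt_b_succ (m + 2) x
    have h3 := ((((hasDerivAt_id x).const_add s).const_mul 2).mul
      ((hasDerivAt_id x).sub (h1.const_mul (2 ^ (m + 1))))).sub ((hasDerivAt_id x).pow 2)
    convert! h3.add (h2.const_mul (2 * 2 ^ (m + 1))) using 1
    simp only [D, id, Pi.sub_apply]
    ring
  have hint : ∀ s x y, ∫ a in x..y, D s a = G s y - G s x := fun s x y =>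
    intervalIntegral.integral_eq_sub_of_hasDerivAt (fun a _ => hG s a)
      ((hD s).intervalIntegrable _ _)
  have e1 : Set.EqOn (D (1 - v)) F (Set.uIoc 0 v) := by
    intro a ha
    rw [Set.uIoc_of_le hv0] at ha
    have : Int.fract (v - a) = v - a :=
      Int.fract_eq_self.2 ⟨by linarith [ha.2], by linarith [ha.1]⟩
    simp only [D, F, this]
    ring
  have e2 : Set.EqOn (D (-v)) F (Set.uIoc v 1) := by
    intro a ha
    rw [Set.uIoc_of_le hv1] at ha
    have : Int.fract (v - a) = v - a + 1 := by
      rw [Int.fract_eq_iff]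
      exact ⟨by linarith [ha.2], by linarith [ha.1], -1, by push_cast; ring⟩
    simp only [D, F, this]
    ring
  have i1 : IntervalIntegrable F volume 0 v := ((hD (1 - v)).intervalIntegrable 0 v).congr e1
  have i2 : IntervalIntegrable F volume v 1 := ((hD (-v)).intervalIntegrable v 1).congr e2
  refine ⟨i1.trans i2, ?_⟩
  rw [← intervalIntegral.integral_add_adjacent_intervals i1 i2,
    ← intervalIntegral.integral_congr_ae (Filter.Eventually.of_forall e1),
    ← intervalIntegral.integral_congr_ae (Filter.Eventually.of_forall e2), hint,
    hint]
  -- The values of `b` at `0` and `1` cancel, leaving `1 - 2v`; the jump of `s` by `1` at `v`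
  -- contributes `2v - 2^(m+2) b_{m+2}(v)`.
  simp only [G, b_one_eq_b_zero m, b_one_eq_b_zero (m + 1)]
  ring

/-- Positivity passes through the integral recursion because the kernel is nonnegative. It makes
`ENNReal.ofReal` harmless in the densities. -/
theorem density_nonneg (m : ℕ) {v : ℝ} (hv : v ∈ Set.Icc (0 : ℝ) 1) :
    0 ≤ 1 - 2 ^ (m + 1) * b (m + 1) v := by
  induction m generalizing v with
  | zero =>
    have : b 1 v = v - 1 / 2 := by simp [b, bernoulliFun_one]
    simp only [zero_add, pow_one, this]
    linarith [hv.2]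
  | succ m ih =>
    rw [← (intervalIntegral_stepDensity m hv).2]
    refine intervalIntegral.integral_nonneg zero_le_one fun a ha => mul_nonneg (ih ha) ?_
    linarith [Int.fract_lt_one (v - a)]

/-- The density of the end of the walk on the circle. -/
theorem map_finalPosition (m : ℕ) : (cube (m + 1)).map finalPosition =
    unif.withDensity fun v => ENNReal.ofReal (1 - 2 ^ (m + 1) * b (m + 1) v) := by
  have hIco : ∀ᵐ v ∂unif, v ∈ Set.Ico (0 : ℝ) 1 := by
    filter_upwards [ae_unif_mem_Ioo] with v hv using ⟨hv.1.le, hv.2⟩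
  induction m with
  | zero =>
    -- The walk of no steps sits at `0`, so one step has density `2 (1 - v) = 1 - 2 b_1(v)`.
    have h0 : (cube 0).map finalPosition = Measure.dirac 0 := by
      have : (finalPosition : (Fin 0 × Fin 2 → ℝ) → ℝ) = fun _ => 0 := by
        ext u
        simp [finalPosition]
      rw [this, Measure.map_const]
      simp
    rw [map_finalPosition_succ (by rw [h0, ae_dirac_eq]; simp), h0]
    refine withDensity_congr_ae ?_
    filter_upwards [hIco] with v hv
    have : b 1 v = v - 1 / 2 := by simp [b, bernoulliFun_one]
    rw [lintegral_dirac, stepDensity, sub_zero, Int.fract_eq_self.2 hv, zero_add, this]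
    congr 1
    ring
  | succ m ih =>
    rw [map_finalPosition_succ (by rw [ih]; exact withDensity_absolutelyContinuous _ _ hIco), ih]
    refine withDensity_congr_ae ?_
    filter_upwards [hIco] with v hv
    have hv' : v ∈ Set.Icc (0 : ℝ) 1 := ⟨hv.1, hv.2.le⟩
    obtain ⟨h1, h2⟩ := intervalIntegral_stepDensity m hv'
    have hb := (continuous_b (m + 1)).measurable
    have hpos : 0 ≤ᵐ[volume.restrict (Set.Ioc (0 : ℝ) 1)]
        fun a => (1 - 2 ^ (m + 1) * b (m + 1) a) * (2 * (1 - Int.fract (v - a))) := by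
      filter_upwards [ae_restrict_mem measurableSet_Ioc] with a ha
      refine mul_nonneg (density_nonneg m ⟨ha.1.le, ha.2⟩) ?_
      linarith [Int.fract_lt_one (v - a)]
    rw [lintegral_withDensity_eq_lintegral_mul _ (by fun_prop)
      (by unfold stepDensity; fun_prop), ← h2, intervalIntegral.integral_of_le zero_le_one,
      ofReal_integral_eq_lintegral_ofReal ((intervalIntegrable_iff_integrableOn_Ioc_of_le
        zero_le_one).1 h1) hpos, unif, Measure.restrict_congr_set (Ico_ae_eq_Ioc (μ := volume))]
    refine setLIntegral_congr_fun measurableSet_Ioc fun a ha => ?_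
    simp only [Pi.mul_apply, stepDensity]
    rw [ENNReal.ofReal_mul (density_nonneg m ⟨ha.1.le, ha.2⟩)]

theorem cube_real_finalPosition_le_eq_integral (m : ℕ) {c : ℝ} (hc : c ∈ Set.Icc (0 : ℝ) 1) :
    (cube (m + 1)).real {u | finalPosition u ≤ c} =
      ∫ v in (0 : ℝ)..c, (1 - 2 ^ (m + 1) * b (m + 1) v) := by
  have hcont : Continuous fun v => 1 - 2 ^ (m + 1) * b (m + 1) v := by
    have := continuous_b (m + 1)
    fun_prop
  have h1 : cube (m + 1) {u | finalPosition u ≤ c} = (cube (m + 1)).map finalPosition (Set.Iic c) :=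
    (Measure.map_apply (measurable_finalPosition _) measurableSet_Iic).symm
  have h2 : (Set.Iic c ∩ Set.Ioc 0 1 : Set ℝ) = Set.Ioc 0 c := by
    ext v
    simp only [Set.mem_inter_iff, Set.mem_Iic, Set.mem_Ioc]
    exact ⟨fun h => ⟨h.2.1, h.1⟩, fun h => ⟨h.2, h.1, h.2.trans hc.2⟩⟩
  have hpos : 0 ≤ᵐ[volume.restrict (Set.Ioc (0 : ℝ) c)]
      fun v => 1 - 2 ^ (m + 1) * b (m + 1) v := by
    filter_upwards [ae_restrict_mem measurableSet_Ioc] with a ha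
    exact density_nonneg m ⟨ha.1.le, ha.2.trans hc.2⟩
  rw [measureReal_def, h1, map_finalPosition, withDensity_apply _ measurableSet_Iic, unif,
    Measure.restrict_congr_set (Ico_ae_eq_Ioc (μ := volume)),
    Measure.restrict_restrict measurableSet_Iic, h2,
    ← ofReal_integral_eq_lintegral_ofReal ((intervalIntegrable_iff_integrableOn_Ioc_of_le
        hc.1).1 (hcont.intervalIntegrable _ _)) hpos, intervalIntegral.integral_of_le hc.1,
    ENNReal.toReal_ofReal (integral_nonneg_of_ae hpos)]

/-! ### Bernstein polynomials -/

theorem f_eq_eval_bernstein {k N : ℕ} (hk : k ∈ Finset.Icc 1 N) (u : ℝ) :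
    f k N u = N * (bernsteinPolynomial ℝ (N - 1) (k - 1)).eval u := by
  obtain ⟨h1, h2⟩ := Finset.mem_Icc.1 hk
  obtain ⟨k, rfl⟩ := Nat.exists_eq_add_of_le' h1
  obtain ⟨N, rfl⟩ := Nat.exists_eq_add_of_le' (h1.trans h2)
  have h3 : k ≤ N := by omega
  have h4 : N + 1 - (k + 1) = N - k := by omega
  simp only [f, bernsteinPolynomial, Nat.add_sub_cancel, Polynomial.eval_mul,
    Polynomial.eval_pow, Polynomial.eval_sub, Polynomial.eval_one, Polynomial.eval_X,
    Polynomial.eval_natCast, h4]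
  rw [Nat.cast_choose ℝ h3, Nat.factorial_succ]
  push_cast
  ring

theorem f_one_sub {k N : ℕ} (hk : k ∈ Finset.Icc 1 N) (u : ℝ) :
    f k N (1 - u) = f (N + 1 - k) N u := by
  obtain ⟨h1, h2⟩ := Finset.mem_Icc.1 hk
  have h3 : N + 1 - k - 1 = N - k := by omega
  have h4 : N - (N + 1 - k) = k - 1 := by omega
  rw [f, f, h3, h4, sub_sub_cancel, mul_comm ((k - 1)! : ℝ)]
  ring

theorem sum_f {N : ℕ} (hN : 0 < N) (u : ℝ) : ∑ k ∈ Finset.Icc 1 N, f k N u = N := by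
  rw [Finset.sum_congr rfl fun k hk => f_eq_eval_bernstein hk u, ← Finset.mul_sum,
    ← Polynomial.eval_finsetSum]
  have h1 : ∑ k ∈ Finset.Icc 1 N, bernsteinPolynomial ℝ (N - 1) (k - 1) = 1 := by
    rw [← bernsteinPolynomial.sum ℝ (N - 1), Nat.sub_add_cancel hN]
    refine Finset.sum_nbij' (fun k => k - 1) (fun k => k + 1) ?_ ?_ ?_ ?_
        fun _ _ => rfl <;>
      simp only [Finset.mem_Icc, Finset.mem_range] <;> intros <;> omega
  rw [h1, Polynomial.eval_one, mul_one]

theorem f_zero {k N : ℕ} (hk : k ∈ Finset.Icc 1 N) :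
    f k N 0 = if k = 1 then (N : ℝ) else 0 := by
  rw [f_eq_eval_bernstein hk, bernsteinPolynomial.eval_at_0]
  obtain ⟨h1, h2⟩ := Finset.mem_Icc.1 hk
  have : k - 1 = 0 ↔ k = 1 := by omega
  simp [this]

/-- Substituting `u = y / (1 + y)` and multiplying by `(1 + y)^(N-1)` turns each `f k N` into a
nonzero multiple of `y^(k-1)`. -/
theorem eq_zero_of_sum_mul_f_eq_zero {N : ℕ} {c : ℕ → ℝ}
    (h : ∀ u, ∑ k ∈ Finset.Icc 1 N, c k * f k N u = 0) {k : ℕ} (hk : k ∈ Finset.Icc 1 N) :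
    c k = 0 := by
  let A : ℕ → ℝ := fun k => (N ! : ℝ) / (((k - 1)! : ℝ) * ((N - k)! : ℝ))
  let P : Polynomial ℝ := ∑ k ∈ Finset.Icc 1 N, Polynomial.monomial (k - 1) (c k * A k)
  have hP : P = 0 := by
    refine Polynomial.eq_zero_of_infinite_isRoot P ((Set.Ioi_infinite (0 : ℝ)).mono ?_)
    intro y hy
    have hy' : (0 : ℝ) < 1 + y := by linarith [Set.mem_Ioi.1 hy]
    have h1 : P.eval y = (1 + y) ^ (N - 1) * ∑ k ∈ Finset.Icc 1 N, c k * f k N (y / (1 + y)) := by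
      simp only [P]
      rw [Polynomial.eval_finsetSum, Finset.mul_sum]
      refine Finset.sum_congr rfl fun j hj => ?_
      obtain ⟨h1, h2⟩ := Finset.mem_Icc.1 hj
      have h3 : 1 - y / (1 + y) = 1 / (1 + y) := by field_simp; ring
      have h4 : N - 1 = (j - 1) + (N - j) := by omega
      rw [Polynomial.eval_monomial, f, h3, h4, pow_add, div_pow, div_pow, one_pow]
      simp only [A]
      field_simp
    rw [Set.mem_ofPred_eq, Polynomial.IsRoot, h1, h, mul_zero]
  obtain ⟨h1, h2⟩ := Finset.mem_Icc.1 hk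
  have h3 : P.coeff (k - 1) = c k * A k := by
    simp only [P, Polynomial.finsetSum_coeff, Polynomial.coeff_monomial]
    rw [Finset.sum_eq_single_of_mem k hk, if_pos rfl]
    intro j hj hne
    have := (Finset.mem_Icc.1 hj).1
    rw [if_neg (by omega)]
  rw [hP, Polynomial.coeff_zero] at h3
  have h4 : A k ≠ 0 := by simp only [A]; positivity
  exact (mul_eq_zero.1 h3.symm).resolve_right h4

/-- Each derivative is a difference of consecutive Bernstein polynomials of lower degree, so the sum
telescopes. -/
theorem derivative_sum_bernstein (N i d : ℕ) :
    Polynomial.derivative (∑ j ∈ Finset.Ioc i (i + d), bernsteinPolynomial ℝ N j) =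
      N * (bernsteinPolynomial ℝ (N - 1) i - bernsteinPolynomial ℝ (N - 1) (i + d)) := by
  induction d with
  | zero => simp
  | succ d ih =>
    rw [← add_assoc, Finset.sum_Ioc_succ_top (by omega), Polynomial.derivative_add, ih,
      bernsteinPolynomial.derivative_succ]
    ring

theorem hasDerivAt_sum_choose {k N : ℕ} (hk : k ∈ Finset.Icc 1 N) (u : ℝ) :
    HasDerivAt (fun c : ℝ => ∑ j ∈ Finset.Icc k N, (N.choose j : ℝ) * c ^ j * (1 - c) ^ (N - j))
      (f k N u) u := by
  have h := Polynomial.hasDerivAt (∑ j ∈ Finset.Icc k N, bernsteinPolynomial ℝ N j) u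
  obtain ⟨h1, h2⟩ := Finset.mem_Icc.1 hk
  have h3 : Finset.Icc k N = Finset.Ioc (k - 1) (k - 1 + (N - (k - 1))) := by
    ext
    simp only [Finset.mem_Icc, Finset.mem_Ioc]
    omega
  have h4 : (Polynomial.derivative (∑ j ∈ Finset.Icc k N, bernsteinPolynomial ℝ N j)).eval u =
      f k N u := by
    -- The upper telescoping term has index `N` in degree `N - 1`, so it vanishes.
    rw [f_eq_eval_bernstein hk, h3, derivative_sum_bernstein,
      bernsteinPolynomial.eq_zero_of_lt ℝ (by omega : N - 1 < k - 1 + (N - (k - 1)))]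
    simp
  rw [h4] at h
  refine h.congr_of_eventuallyEq (Filter.Eventually.of_forall fun c => ?_)
  simp [Polynomial.eval_finsetSum, bernsteinPolynomial]

/-! ### The law of the end of the walk -/

/-- Both sides are derivatives of the distribution function of the end of the walk. -/
theorem sum_p_mul_f_of_mem_Ioo (m : ℕ) {u : ℝ} (hu : u ∈ Set.Ioo (0 : ℝ) 1) :
    ∑ k ∈ Finset.Icc 1 (2 * (m + 1)), p k (m + 1) * f k (2 * (m + 1)) u =
      1 - 2 ^ (m + 1) * b (m + 1) u := by
  have hcont : Continuous fun v => 1 - 2 ^ (m + 1) * b (m + 1) v := by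
    have := continuous_b (m + 1)
    fun_prop
  have h1 : HasDerivAt (fun c => ∫ v in (0 : ℝ)..c, (1 - 2 ^ (m + 1) * b (m + 1) v))
      (1 - 2 ^ (m + 1) * b (m + 1) u) u :=
    intervalIntegral.integral_hasDerivAt_right (hcont.intervalIntegrable _ _)
      (hcont.stronglyMeasurableAtFilter _ _) hcont.continuousAt
  have h2 := HasDerivAt.fun_sum (u := Finset.Icc 1 (2 * (m + 1))) fun k hk =>
    (hasDerivAt_sum_choose hk u).const_mul (p k (m + 1))
  refine h2.unique (h1.congr_of_eventuallyEq ?_)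
  filter_upwards [isOpen_Ioo.mem_nhds hu] with c hc
  have hc' : c ∈ Set.Icc (0 : ℝ) 1 := ⟨hc.1.le, hc.2.le⟩
  rw [← cube_real_finalPosition_le_eq_integral m hc', cube_real_finalPosition_le m.succ_pos hc']

/-- Both sides are polynomials in `u`, so agreement on `(0, 1)` suffices. -/
theorem sum_p_mul_f {n : ℕ} (hn : 0 < n) (u : ℝ) :
    ∑ k ∈ Finset.Icc 1 (2 * n), p k n * f k (2 * n) u = 1 - 2 ^ n * b n u := by
  obtain ⟨m, rfl⟩ := Nat.exists_eq_succ_of_ne_zero hn.ne'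
  let P : Polynomial ℝ := ∑ k ∈ Finset.Icc 1 (2 * (m + 1)), Polynomial.C (p k (m + 1)) *
    (((2 * (m + 1) : ℕ) : Polynomial ℝ) * bernsteinPolynomial ℝ (2 * (m + 1) - 1) (k - 1))
  let Q : Polynomial ℝ := 1 - Polynomial.C (2 ^ (m + 1) / ((m + 1)! : ℝ)) *
    (Polynomial.bernoulli (m + 1)).map (algebraMap ℚ ℝ)
  have hP : ∀ x, P.eval x =
      ∑ k ∈ Finset.Icc 1 (2 * (m + 1)), p k (m + 1) * f k (2 * (m + 1)) x := by
    intro x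
    simp only [P]
    rw [Polynomial.eval_finsetSum]
    refine Finset.sum_congr rfl fun k hk => ?_
    rw [f_eq_eval_bernstein hk, Polynomial.eval_mul, Polynomial.eval_C, Polynomial.eval_mul,
      Polynomial.eval_natCast]
  have hQ : ∀ x, Q.eval x = 1 - 2 ^ (m + 1) * b (m + 1) x := by
    intro x
    simp only [Q, b, bernoulliFun, Polynomial.eval_sub, Polynomial.eval_mul, Polynomial.eval_C,
      Polynomial.eval_one]
    ring
  have hPQ : P = Q := by
    refine Polynomial.eq_of_infinite_eval_eq P Q ((Set.Ioo_infinite (zero_lt_one (α := ℝ))).mono ?_)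
    intro x hx
    rw [Set.mem_ofPred_eq, hP, hQ, sum_p_mul_f_of_mem_Ioo m hx]
  rw [← hP, hPQ, hQ]

theorem b_eq_sum_δ_mul_f {n : ℕ} (hn : 0 < n) (u : ℝ) :
    b n u = (1 / 2 ^ n) * ∑ k ∈ Finset.Icc 1 (2 * n), δ k n * f k (2 * n) u := by
  have h1 : (n : ℝ) ≠ 0 := by positivity
  simp only [δ, sub_mul, Finset.sum_sub_distrib, ← Finset.mul_sum]
  rw [sum_p_mul_f hn, sum_f (by omega)]
  push_cast
  field_simp
  ring

/-- Reflecting `u` to `1 - u` multiplies `b n` by `(-1)^n` and reverses the order of the `f k (2 *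
n)`; coefficients are then compared. -/
theorem δ_reflect {n : ℕ} (hn : 0 < n) {k : ℕ} (hk : k ∈ Finset.Icc 1 (2 * n)) :
    δ (2 * n + 1 - k) n = (-1) ^ n * δ k n := by
  rw [← sub_eq_zero]
  refine eq_zero_of_sum_mul_f_eq_zero (N := 2 * n)
    (c := fun k => δ (2 * n + 1 - k) n - (-1) ^ n * δ k n) (fun u => ?_) hk
  have h1 : b n (1 - u) = (-1) ^ n * b n u := by
    rw [b, b, bernoulliFun_eval_one_sub, mul_div_assoc]
  rw [b_eq_sum_δ_mul_f hn, b_eq_sum_δ_mul_f hn] at h1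
  have h2 : ∑ k ∈ Finset.Icc 1 (2 * n), δ k n * f k (2 * n) (1 - u) =
      ∑ k ∈ Finset.Icc 1 (2 * n), δ (2 * n + 1 - k) n * f k (2 * n) u := by
    refine Finset.sum_nbij' (fun k => 2 * n + 1 - k) (fun k => 2 * n + 1 - k) ?_ ?_ ?_ ?_ ?_
    · intro k hk
      rw [Finset.mem_Icc] at hk ⊢
      omega
    · intro k hk
      rw [Finset.mem_Icc] at hk ⊢
      omega
    · intro k hk
      rw [Finset.mem_Icc] at hk
      omega
    · intro k hk
      rw [Finset.mem_Icc] at hk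
      omega
    · intro k hk
      rw [f_one_sub hk]
      rw [Finset.mem_Icc] at hk
      rw [show 2 * n + 1 - (2 * n + 1 - k) = k by omega]
  rw [h2] at h1
  simp only [sub_mul, Finset.sum_sub_distrib, mul_assoc, ← Finset.mul_sum]
  have h3 : (1 / 2 ^ n : ℝ) ≠ 0 := by positivity
  refine mul_left_cancel₀ h3 ?_
  rw [mul_sub, h1]
  ring

theorem p_one_eq {n : ℕ} (hn : 0 < n) : p 1 n = (1 - 2 ^ n * b n 0) / (2 * (n : ℝ)) := by
  have h1 : (n : ℝ) ≠ 0 := by positivity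
  have h2 : 1 ∈ Finset.Icc 1 (2 * n) := Finset.mem_Icc.2 ⟨le_rfl, by omega⟩
  rw [← sum_p_mul_f hn, Finset.sum_eq_single_of_mem 1 h2, f_zero h2, if_pos rfl]
  · push_cast
    field_simp
  · intro k hk hne
    rw [f_zero hk, if_neg hne, mul_zero]

end BernoulliClock

theorem mainTheorem6 (n : ℕ) (hn : 0 < n) :
    -- the clock with i.i.d. uniform positions on the circle gives the same law of `I_n`
    (∀ (Ω : Type*) [MeasurableSpace Ω] (μ : Measure Ω) [IsProbabilityMeasure μ]
      (U : Fin n × Fin 2 → Ω → ℝ),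
      (∀ q, Measurable (U q)) →
      (∀ q, μ.map (U q) = volume.restrict (Set.Ico (0 : ℝ) 1)) →
      iIndepFun U μ →
      ∀ k : ℕ, μ.real {ω | BernoulliClock.finalIndex (fun q => U q ω) = k} =
        BernoulliClock.p k n) ∧
    (∀ u : ℝ, BernoulliClock.b n u =
      (1 / 2 ^ n) * ∑ k ∈ Finset.Icc 1 (2 * n),
        BernoulliClock.δ k n * BernoulliClock.f k (2 * n) u) ∧
    (∀ k ∈ Finset.Icc 1 (2 * n),
      BernoulliClock.δ (2 * n + 1 - k) n = (-1) ^ n * BernoulliClock.δ k n) ∧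
    BernoulliClock.p 1 n = (1 - 2 ^ n * BernoulliClock.b n 0) / (2 * (n : ℝ)) := by
  exact ⟨fun Ω _ μ _ U hU hlaw hind k =>
      BernoulliClock.measureReal_finalIndex_eq hn μ U hU hlaw hind k,
    BernoulliClock.b_eq_sum_δ_mul_f hn, fun _ hk => BernoulliClock.δ_reflect hn hk,
    BernoulliClock.p_one_eq hn⟩
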